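/- All digraphs and graphs are finite and have no loops or multiple arcs/edges. Write $u\leftrightarrow v$ if both arcs $(u,v)$ and $(v,u)$ are present, and $u\to v$ if only $(u,v)$ is; pairs that are not listed are non-adjacent. For vertex-disjoint digraphs $G_1,G_2$, the disjoint union $G_1\oplus G_2$ has no arcs between $G_1$ and $G_2$; the series composition $G_1\otimes G_2$ adds all arcs between $V(G_1)$ and $V(G_2)$ in both directions; the order composition $G_1\oslash G_2$ adds all arcs from $V(G_1)$ to $V(G_2)$. The class of directed weakly quasi threshold graphs is the smallest class of digraphs (closed under isomorphism) that contains all edgeless digraphs, contains $G_1\oplus G_2$ whenever it contains $G_1$ and $G_2$, and contains $G\oslash I$, $I\oslash G$ and $G\otimes I$ whenever it contains $G$ and $I$ is edgeless. The class of (undirected) weakly quasi threshold graphs is the smallest class of graphs (closed under isomorphism) that contains all edgeless graphs, contains the disjoint union of any two of its members, and contains the join of any member with an edgeless graph. The underlying graph $\mathrm{un}(G)$ has the edge $\{u,v\}$ whenever $(u,v)$ or $(v,u)$ is an arc of $G$. A (di)graph is in $\mathrm{Free}(F)$ if none of its induced sub(di)graphs is isomorphic to a member of $F$. Let - $D_1$: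 $a\to b\to c$; $D_2$: $a\leftrightarrow b\to c$; $D_3$: $a\leftrightarrow b\leftarrow c$; - $D_4$: $a\to b\to c$ and $a\leftrightarrow c$; $D_5$: the directed $3$-cycle $a\to b\to c\to a$; - $D_7$: $a\leftrightarrow b\leftrightarrow c\leftrightarrow d$; $D_8$: $a\to b\leftarrow c\to d$; $D_6$: the complement of $D_8$; - $Y_1$: $a\leftrightarrow b$; $Y_2$: $a\to b$; $Y_3$ and $Y_4$: the disjoint union of $Y_1$, respectively $Y_2$, with a single vertex; - $Q_1=Y_2\otimes Y_2$, $Q_2=Y_1\oslash Y_1$, $Q_3=Y_3\otimes Y_3$, $Q_4=Y_2\otimes Y_3$, $Q_5=Y_1\oslash Y_4$, $Q_6=Y_4\oslash Y_1$, $Q_7=Y_4\oslash Y_4$. Let $P_n$ be the path on $n$ vertices and $\text{co-}2P_3$ the complement of the disjoint union of two copies of $P_3$. **Theorem.** For every digraph $G$ the following properties are equivalent: 1. $G$ is a directed weakly quasi threshold graph. 2. $G\in \mathrm{Free}(\{D_1,\ldots,D_8,Q_1,\ldots,Q_7\})$. 3. $G\in \mathrm{Free}(\{D_1,\ldots,D_6,Q_1,Q_2,Q_4,Q_5,Q_6\})$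 and $\mathrm{un}(G)\in\mathrm{Free}(\{P_4,\text{co-}2P_3\})$. 4. $G\in \mathrm{Free}(\{D_1,\ldots,D_6,Q_1,Q_2,Q_4,Q_5,Q_6\})$ and $\mathrm{un}(G)$ is a weakly quasi threshold graph. -/

import Mathlib

namespace DirectedWQT

universe u

/-! ### Operations on digraphs with disjoint vertex sets -/

/-- The disjoint union `G ⊕ H` of two digraphs. -/
def disjUnion {V W : Type*} (G : Digraph V) (H : Digraph W) : Digraph (V ⊕ W) where
  Adj
    | .inl a, .inl b => G.Adj a b
    | .inr a, .inr b => H.Adj a b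
    | .inl _, .inr _ => False
    | .inr _, .inl _ => False

/-- The series composition `G ⊗ H`: all arcs between `G` and `H`, in both directions. -/
def series {V W : Type*} (G : Digraph V) (H : Digraph W) : Digraph (V ⊕ W) where
  Adj
    | .inl a, .inl b => G.Adj a b
    | .inr a, .inr b => H.Adj a b
    | .inl _, .inr _ => True
    | .inr _, .inl _ => True

/-- The order composition `G ⊘ H`: all arcs from `G` to `H`. -/
def order {V W : Type*} (G : Digraph V) (H : Digraph W) : Digraph (V ⊕ W) where
  Adj
    | .inl a, .inl b => G.Adj a b
    | .inr a, .inr b => H.Adj a b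
    | .inl _, .inr _ => True
    | .inr _, .inl _ => False

/-- Directed weakly quasi threshold graphs. `⊥` is the edgeless digraph; the constructor `iso`
says that the class does not depend on the names of the vertices. -/
inductive IsDWQT : {V : Type u} → Digraph V → Prop
  | edgeless (V : Type u) [Finite V] : IsDWQT (⊥ : Digraph V)
  | disjUnion {V W : Type u} {G : Digraph V} {H : Digraph W} :
      IsDWQT G → IsDWQT H → IsDWQT (disjUnion G H)
  | orderRight {V : Type u} {G : Digraph V} (W : Type u) [Finite W] :
      IsDWQT G → IsDWQT (order G (⊥ : Digraph W))
  | orderLeft {V : Type u} {G : Digraph V} (W : Type u) [Finite W] :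
      IsDWQT G → IsDWQT (order (⊥ : Digraph W) G)
  | series {V : Type u} {G : Digraph V} (W : Type u) [Finite W] :
      IsDWQT G → IsDWQT (series G (⊥ : Digraph W))
  | iso {V W : Type u} {G : Digraph V} {H : Digraph W} :
      (G.Adj ≃r H.Adj) → IsDWQT G → IsDWQT H

/-! ### Undirected graphs -/

/-- The join `G ⊗ H` of two undirected graphs. -/
def join {V W : Type*} (G : SimpleGraph V) (H : SimpleGraph W) : SimpleGraph (V ⊕ W) :=
  G.sum H ⊔ completeBipartiteGraph V W

/-- (Undirected) weakly quasi threshold graphs. -/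
inductive IsWQT : {V : Type u} → SimpleGraph V → Prop
  | edgeless (V : Type u) [Finite V] : IsWQT (⊥ : SimpleGraph V)
  | disjUnion {V W : Type u} {G : SimpleGraph V} {H : SimpleGraph W} :
      IsWQT G → IsWQT H → IsWQT (G.sum H)
  | join {V : Type u} {G : SimpleGraph V} (W : Type u) [Finite W] :
      IsWQT G → IsWQT (join G (⊥ : SimpleGraph W))
  | iso {V W : Type u} {G : SimpleGraph V} {H : SimpleGraph W} :
      (G ≃g H) → IsWQT G → IsWQT H

/-- The underlying undirected graph `un(G)`. -/
def un {V : Type*} (G : Digraph V) : SimpleGraph V := G.toSimpleGraphInclusive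

/-! ### Forbidden induced sub(di)graphs -/

/-- `G ∈ Free(F)`: no induced subdigraph of `G` is isomorphic to a member of `F`. -/
def Free {V : Type*} (F : Set (Σ W : Type, Digraph W)) (G : Digraph V) : Prop :=
  ∀ H ∈ F, ¬ Nonempty (H.2.Adj ↪r G.Adj)

/-- `G ∈ Free(F)` for undirected graphs. -/
def UFree {V : Type*} (F : Set (Σ W : Type, SimpleGraph W)) (G : SimpleGraph V) : Prop :=
  ∀ H ∈ F, ¬ H.2.IsIndContained G

/-- The digraph on `Fin n` with the listed arcs. -/
def ofArcs (n : ℕ) (l : List (Fin n × Fin n)) : Digraph (Fin n) where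
  Adj a b := (a, b) ∈ l

/-- The oriented path with arcs `0 → 1 → 2`. -/
def D1 : Digraph (Fin 3) := ofArcs 3 [(0, 1), (1, 2)]

/-- `0 ↔ 1 → 2`. -/
def D2 : Digraph (Fin 3) := ofArcs 3 [(0, 1), (1, 0), (1, 2)]

/-- `0 ↔ 1 ← 2`. -/
def D3 : Digraph (Fin 3) := ofArcs 3 [(0, 1), (1, 0), (2, 1)]

/-- `0 → 1 → 2` and `0 ↔ 2`: the complement of `D1`, up to isomorphism. -/
def D4 : Digraph (Fin 3) := ofArcs 3 [(0, 1), (1, 2), (0, 2), (2, 0)]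

/-- The oriented cycle on three vertices. -/
def D5 : Digraph (Fin 3) := ofArcs 3 [(0, 1), (1, 2), (2, 0)]

/-- `1 → 0`, `1 → 2`, `3 → 2`, `0 ↔ 2`, `0 ↔ 3`, `1 ↔ 3`: the complement of `D8`. -/
def D6 : Digraph (Fin 4) :=
  ofArcs 4 [(1, 0), (1, 2), (3, 2), (0, 2), (2, 0), (0, 3), (3, 0), (1, 3), (3, 1)]

/-- The complete biorientation of the path `P₄`. -/
def D7 : Digraph (Fin 4) := ofArcs 4 [(0, 1), (1, 0), (1, 2), (2, 1), (2, 3), (3, 2)]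

/-- The transitive orientation `0 → 1 ← 2 → 3` of the path `P₄`. -/
def D8 : Digraph (Fin 4) := ofArcs 4 [(0, 1), (2, 1), (2, 3)]

/-- Two vertices joined in both directions. -/
def Y1 : Digraph (Fin 2) := ofArcs 2 [(0, 1), (1, 0)]

/-- A single arc. -/
def Y2 : Digraph (Fin 2) := ofArcs 2 [(0, 1)]

/-- Two vertices joined in both directions, and an isolated vertex. -/
def Y3 : Digraph (Fin 3) := ofArcs 3 [(0, 1), (1, 0)]

/-- A single arc, and an isolated vertex. -/
def Y4 : Digraph (Fin 3) := ofArcs 3 [(0, 1)]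

def Q1 : Digraph (Fin 2 ⊕ Fin 2) := series Y2 Y2
def Q2 : Digraph (Fin 2 ⊕ Fin 2) := order Y1 Y1
def Q3 : Digraph (Fin 3 ⊕ Fin 3) := series Y3 Y3
def Q4 : Digraph (Fin 2 ⊕ Fin 3) := series Y2 Y3
def Q5 : Digraph (Fin 2 ⊕ Fin 3) := order Y1 Y4
def Q6 : Digraph (Fin 3 ⊕ Fin 2) := order Y4 Y1
def Q7 : Digraph (Fin 3 ⊕ Fin 3) := order Y4 Y4

/-- The path `P₄`. -/
def P4 : SimpleGraph (Fin 4) := SimpleGraph.pathGraph 4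

/-- `co-2P₃`, the complement of the disjoint union of two paths on three vertices. -/
def co2P3 : SimpleGraph (Fin 3 ⊕ Fin 3) :=
  ((SimpleGraph.pathGraph 3).sum (SimpleGraph.pathGraph 3))ᶜ

end DirectedWQT

/-! The substance is that a digraph free of the fifteen digraphs can be built. Classify pairs as
nonadjacent, simple arc or bidirectional. Freeness from `D1`–`D8` says that simple arcs are
transitive, that no triple shows all three kinds, and that three patterns on four vertices are
absent. Then neither the underlying graph nor the graph of bidirectional pairs has an induced path
on four vertices, so each of them, or its complement, is disconnected. This yields a cut whose
crossing pairs are all nonadjacent, all bidirectional, or all simple arcs in one direction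
(`IsDirectedCograph.exists_isCut`). A factor of such a cut need not be edgeless, but a smallest one
inside a given side is, unless that side contains `Y2` or `Y3` (series), or `Y1` or `Y4` (order). If
both sides fail, the two copies together form one of `Q1`–`Q7`. Hence an edgeless factor splits off,
and induction on the number of vertices applies. Conversely, each forbidden (di)graph has an edge
and is split by none of the generating operations, so it lies inside one factor whenever it embeds
in a composition (`IsObstruction`). Passing to `un` turns generating operations into generating
operations, and maps `D7`, `D8` to `P4` and `Q3`, `Q7` to `co2P3`, which links the undirected
conditions with the list. -/

namespace DirectedWQT

universe u

/-! ### Cuts, and graphs without induced paths on four vertices -/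

section Relations

variable {V : Type*} {r R : V → V → Prop}

/-- `a → b`, and not `b → a`. -/
def Arc (r : V → V → Prop) (a b : V) : Prop := r a b ∧ ¬ r b a

/-- `a ↔ b`. -/
def Edge (r : V → V → Prop) (a b : V) : Prop := r a b ∧ r b a

/-- No arc between `a` and `b`. -/
def Non (r : V → V → Prop) (a b : V) : Prop := ¬ r a b ∧ ¬ r b a

/-- `S` has a bipartition into nonempty parts with `R` everywhere between them. -/
def HasCut (R : V → V → Prop) (S : Set V) : Prop :=
  ∃ T U : Set V, T ∪ U = S ∧ Disjoint T U ∧ T.Nonempty ∧ U.Nonempty ∧ ∀ x ∈ T, ∀ y ∈ U, R x y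

/-- `R`, a symmetric relation, contains no induced path on four vertices. -/
def PathFree (R : V → V → Prop) : Prop :=
  ∀ a b c d, R a b → R b c → R c d → ¬ R a c → ¬ R b d → ¬ R a d → False

/-- The path on four vertices is self-complementary: `a b c d` becomes `b d a c`. -/
lemma PathFree.not (hs : ∀ x y, R x y → R y x) (h : PathFree R) :
    PathFree (fun x y ↦ ¬ R x y) := by
  intro a b c d h1 h2 h3 h4 h5 h6
  simp only [not_not] at h4 h5 h6
  exact h b d a c h5 (hs _ _ h6) h4 (fun h ↦ h1 (hs _ _ h)) (fun h ↦ h3 (hs _ _ h)) h2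

lemma PathFree.hasCut_insert_aux (h : PathFree R) {T U : Set V} {v u : V}
    (hd : Disjoint T U) (hU : U.Nonempty) (hTU : ∀ x ∈ T, ∀ y ∈ U, ¬ R x y)
    (hv : v ∉ T ∪ U) (hu : u ∈ T) (huv : ¬ R u v) :
    HasCut (fun x y ↦ ¬ R x y) (insert v (T ∪ U)) := by
  have hvT : v ∉ T := fun h ↦ hv (Or.inl h)
  have hvU : v ∉ U := fun h ↦ hv (Or.inr h)
  have hdis : ∀ x ∈ T, x ∉ U := fun x hx hx' ↦ Set.disjoint_left.1 hd hx hx'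
  by_cases hz : ∃ z ∈ U, R v z
  · obtain ⟨z, hzU, hz⟩ := hz
    -- A non-neighbour `y` of `v` in `T` cannot be related to a neighbour `x` of `v` in `T`, since
    -- `y x v z` would be an induced path.
    refine ⟨{x ∈ T | ¬ R x v}, insert v ({x ∈ T | R x v} ∪ U), ?_, ?_, ⟨u, hu, huv⟩,
      ⟨v, Or.inl rfl⟩, ?_⟩
    · ext x
      simp only [Set.mem_union, Set.mem_insert_iff, Set.mem_ofPred_eq]
      tauto
    · rw [Set.disjoint_left]
      rintro x ⟨hx, hxv⟩ (rfl | hx' | hx')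
      · exact hvT hx
      · exact hxv hx'.2
      · exact hdis x hx hx'
    · rintro y ⟨hy, hyv⟩ x (rfl | hx | hx) hyx
      · exact hyv hyx
      · exact h y x v z hyx hx.2 hz hyv (hTU x hx.1 z hzU) (hTU y hy z hzU)
      · exact hTU y hy x hx hyx
  · push Not at hz
    refine ⟨insert v T, U, Set.insert_union, ?_, ⟨v, Or.inl rfl⟩, hU, ?_⟩
    · rw [Set.disjoint_left]
      rintro x (rfl | hx)
      · exact hvU
      · exact hdis x hx
    · rintro x (rfl | hx) y hy
      · exact hz y hy
      · exact hTU x hx y hy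

lemma PathFree.hasCut_insert (hs : ∀ x y, R x y → R y x) (h : PathFree R) {S : Set V} {v : V}
    (hv : v ∉ S) (hS : HasCut (fun x y ↦ ¬ R x y) S) :
    HasCut R (insert v S) ∨ HasCut (fun x y ↦ ¬ R x y) (insert v S) := by
  obtain ⟨T, U, rfl, hd, hT, hU, hTU⟩ := hS
  by_cases hu : ∃ u ∈ T ∪ U, ¬ R u v
  · right
    obtain ⟨u, hu | hu, huv⟩ := hu
    · exact h.hasCut_insert_aux hd hU hTU hv hu huv
    · rw [Set.union_comm] at hv ⊢
      exact h.hasCut_insert_aux hd.symm hT (fun x hx y hy hxy ↦ hTU y hy x hx (hs _ _ hxy))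
        hv hu huv
  · left
    push Not at hu
    refine ⟨T ∪ U, {v}, Set.union_singleton, by simpa using hv, hT.mono Set.subset_union_left,
      ⟨v, rfl⟩, ?_⟩
    rintro x hx y rfl
    exact hu x hx

/-- Seinsche's theorem, by adding one vertex at a time: a new vertex either is related to everything
old or can be placed in an old separation. Complementation exchanges the two alternatives. -/
lemma PathFree.hasCut (hs : ∀ x y, R x y → R y x) (h : PathFree R) (S : Finset V)
    (hS : S.Nontrivial) : HasCut R S ∨ HasCut (fun x y ↦ ¬ R x y) S := by
  classical
  induction S using Finset.induction_on with
  | empty => simp at hS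
  | insert v S hv ih =>
    rw [Finset.coe_insert]
    by_cases hS' : S.Nontrivial
    · rcases ih hS' with hc | hc
      · have := (h.not hs).hasCut_insert (fun x y hxy hyx ↦ hxy (hs _ _ hyx))
          (show v ∉ (S : Set V) by simpa using hv) (by simpa only [not_not] using hc)
        simpa only [not_not, or_comm] using this
      · exact h.hasCut_insert hs (by simpa using hv) hc
    · have hne : S.Nonempty := by
        rw [Finset.nonempty_iff_ne_empty]
        rintro rfl
        simp at hS
      obtain ⟨u, rfl⟩ := hne.exists_eq_singleton_or_nontrivial.resolve_right hS'
      have hvu : Disjoint ({v} : Set V) {u} := by simpa using hv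
      by_cases hR : R v u
      · exact Or.inl ⟨{v}, {u}, by simp [Set.pair_comm], hvu, ⟨v, rfl⟩, ⟨u, rfl⟩, by simpa using hR⟩
      · exact Or.inr ⟨{v}, {u}, by simp [Set.pair_comm], hvu, ⟨v, rfl⟩, ⟨u, rfl⟩, by simpa using hR⟩

/-- `S` is a nonempty proper subset of the vertices with `R` from `S` to its complement. -/
def IsCut (R : V → V → Prop) (S : Set V) : Prop :=
  S.Nonempty ∧ Sᶜ.Nonempty ∧ ∀ x ∈ S, ∀ y ∉ S, R x y

lemma PathFree.exists_isCut [Finite V] [Nontrivial V] (hs : ∀ x y, R x y → R y x)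
    (h : PathFree R) : (∃ S, IsCut R S) ∨ ∃ S, IsCut (fun x y ↦ ¬ R x y) S := by
  have aux : ∀ {R' : V → V → Prop}, HasCut R' Set.univ → ∃ S, IsCut R' S := by
    rintro R' ⟨T, U, hun, hd, hT, hU, hTU⟩
    have hc : IsCompl T U := ⟨hd, codisjoint_iff.2 hun⟩
    rw [← hc.compl_eq] at hU hTU
    exact ⟨T, hT, hU, hTU⟩
  have := Fintype.ofFinite V
  have hcut := h.hasCut hs Finset.univ Finset.univ_nontrivial
  rw [Finset.coe_univ] at hcut
  exact hcut.imp aux aux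

/-- The relational form of being free of `D1, …, D8`. -/
structure IsDirectedCograph (r : V → V → Prop) : Prop where
  irrefl : ∀ a, ¬ r a a
  -- Excludes `D1`, `D4` and `D5`, the three ways for consecutive simple arcs not to compose.
  trans : ∀ {a b c}, Arc r a b → Arc r b c → Arc r a c
  -- Excludes `D2` and `D3`, the triples showing all three kinds of pairs.
  rainbow : ∀ {a b c}, Edge r a b → Non r a c → ¬ Arc r b c ∧ ¬ Arc r c b
  co_zigzag : ∀ {a b c d}, Arc r b a → Arc r b c → Arc r d c → Edge r a c → Edge r b d →
    Edge r a d → False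
  path : ∀ {a b c d}, Edge r a b → Edge r b c → Edge r c d → Non r a c → Non r b d →
    Non r a d → False
  zigzag : ∀ {a b c d}, Arc r a b → Arc r c b → Arc r c d → Non r a c → Non r b d →
    Non r a d → False

/-! ### Decomposition of directed cographs -/

namespace IsDirectedCograph

/-- Consecutive pairs of an induced path have nonadjacent ends, so by `rainbow` they are of one
kind. If bidirectional they form `D7`; if simple arcs, transitivity makes them alternate and they
form `D8`. -/
lemma pathFree_adj (h : IsDirectedCograph r) : PathFree (fun x y ↦ r x y ∨ r y x) := by
  intro a b c d h1 h2 h3 h4 h5 h6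
  have t1 := @h.trans a b c
  have t2 := @h.trans c b a
  have t3 := @h.trans b c d
  have t4 := @h.trans d c b
  have r1 := @h.rainbow a b c
  have r2 := @h.rainbow c b a
  have r3 := @h.rainbow b c d
  have r4 := @h.rainbow d c b
  have p := @h.path a b c d
  have z1 := @h.zigzag a b c d
  have z2 := @h.zigzag d c b a
  simp only [Arc, Edge, Non] at *
  grind +splitImp

/-- Again `rainbow` forces the three path pairs to be of one kind. If nonadjacent, the bidirectional
pairs form the path `c a d b`; if simple arcs, they alternate and form `D6`. -/
lemma pathFree_not_edge (h : IsDirectedCograph r) : PathFree (fun x y ↦ ¬ Edge r x y) := by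
  intro a b c d h1 h2 h3 h4 h5 h6
  have t1 := @h.trans a b c
  have t2 := @h.trans c b a
  have t3 := @h.trans b c d
  have t4 := @h.trans d c b
  have r1 := @h.rainbow a c b
  have r2 := @h.rainbow c a b
  have r3 := @h.rainbow b d c
  have r4 := @h.rainbow d b c
  have p := @h.path c a d b
  have z1 := @h.co_zigzag a b c d
  have z2 := @h.co_zigzag d c b a
  simp only [Arc, Edge, Non] at *
  grind +splitImp

lemma swap (h : IsDirectedCograph r) : IsDirectedCograph (fun x y ↦ r y x) where
  irrefl := h.irrefl
  trans h1 h2 := h.trans h2 h1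
  rainbow h1 h2 := (h.rainbow h1.symm h2.symm).symm
  co_zigzag h1 h2 h3 h4 h5 h6 := h.co_zigzag h3 h2 h1 h5 h4 h6
  path h1 h2 h3 h4 h5 h6 := h.path h1.symm h2.symm h3.symm h4.symm h5.symm h6.symm
  zigzag h1 h2 h3 h4 h5 h6 := h.zigzag h3 h2 h1 h5 h4 h6

lemma arc_or_arc_of_not {a b : V} (h1 : ¬ Edge r a b) (h2 : ¬ Non r a b) :
    Arc r a b ∨ Arc r b a := by
  simp only [Arc, Edge, Non] at *
  tauto

/-- Gallai's argument: cuts without nonadjacent pairs and without bidirectional pairs give a cut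
consisting of simple arcs. -/
lemma exists_isCut_arc_or_arc (h : IsDirectedCograph r) {P Q : Set V}
    (hP : IsCut (fun x y ↦ ¬ Non r x y) P) (hQ : IsCut (fun x y ↦ ¬ Edge r x y) Q) :
    ∃ S, IsCut (fun x y ↦ Arc r x y ∨ Arc r y x) S := by
  by_cases hxy : ∃ x ∈ Q, ∃ y ∉ Q, Non r x y
  · obtain ⟨x, hx, y, hy, hxy⟩ := hxy
    -- `P` is a union of components of the nonadjacency relation, so the component of `x` is a
    -- proper subset.
    have hreach : ∀ z, Relation.ReflTransGen (Non r) x z → (x ∈ P ↔ z ∈ P) := by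
      intro z hz
      induction hz with
      | refl => rfl
      | @tail b c _ hbc ih =>
        rw [ih]
        by_contra hne
        by_cases hb : b ∈ P
        · exact hP.2.2 b hb c (by tauto) hbc
        · exact hP.2.2 c (by tauto) b hb hbc.symm
    refine ⟨{z | Relation.ReflTransGen (Non r) x z}, ⟨x, .refl⟩, ?_, ?_⟩
    · by_cases hxP : x ∈ P
      · obtain ⟨z, hz⟩ := hP.2.1
        exact ⟨z, fun hz' ↦ hz ((hreach z hz').1 hxP)⟩
      · obtain ⟨z, hz⟩ := hP.1
        exact ⟨z, fun hz' ↦ hxP ((hreach z hz').2 hz)⟩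
    · intro c hc z hz
      simp only [Set.mem_ofPred_eq] at hc hz
      refine arc_or_arc_of_not (fun hcz ↦ ?_) (fun hcz ↦ hz (hc.tail hcz))
      -- Being joined to `z` bidirectionally passes along nonadjacent pairs of the component, by
      -- `rainbow`. Such a `z` would be joined to both `x` and `y`, which lie on opposite sides of
      -- `Q`.
      have hconst : ∀ w, Relation.ReflTransGen (Non r) x w → (Edge r x z ↔ Edge r w z) := by
        intro w hw
        induction hw with
        | refl => rfl
        | @tail b d hb hbd ih =>
          rw [ih]
          have n1 : ¬ Non r b z := fun hn ↦ hz (hb.tail hn)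
          have n2 : ¬ Non r d z := fun hn ↦ hz ((hb.tail hbd).tail hn)
          have r1 := @h.rainbow b z d
          have r2 := @h.rainbow d z b
          simp only [Arc, Edge, Non] at *
          grind
      have hxz := (hconst c hc).2 hcz
      have hyz := (hconst y (.single hxy)).1 hxz
      by_cases hzQ : z ∈ Q
      · exact hQ.2.2 z hzQ y hy hyz.symm
      · exact hQ.2.2 x hx z hzQ hxz
  · push Not at hxy
    exact ⟨Q, hQ.1, hQ.2.1, fun x hx y hy ↦ arc_or_arc_of_not (hQ.2.2 x hx y hy) (hxy x hx y hy)⟩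

/-- A minimal part is uniform towards each outside vertex, so transitivity can orient the whole cut
consistently. -/
lemma exists_isCut_arc [Finite V] (h : IsDirectedCograph r)
    (hA : ∃ S, IsCut (fun x y ↦ Arc r x y ∨ Arc r y x) S) : ∃ S, IsCut (Arc r) S := by
  obtain ⟨S, hS⟩ := hA
  obtain ⟨C, -, hC⟩ := exists_minimal_le_of_wellFoundedLT _ S hS
  have hmod : ∀ z ∉ C, (∀ w ∈ C, Arc r w z) ∨ ∀ w ∈ C, Arc r z w := by
    intro z hz
    by_contra! hcon
    obtain ⟨⟨w, hw, hwz⟩, ⟨w', hw', hwz'⟩⟩ := hcon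
    have hz1 := (hC.1.2.2 w hw z hz).resolve_left hwz
    have hz2 := (hC.1.2.2 w' hw' z hz).resolve_right hwz'
    -- The out-neighbours of `z` in `C` form a smaller cut: the remaining vertices of `C` point to
    -- `z`, hence to these.
    refine hwz' (hC.2 (y := {x ∈ C | Arc r z x}) ⟨⟨w, hw, hz1⟩, ⟨z, fun h' ↦ hz h'.1⟩, ?_⟩
      (fun x hx ↦ hx.1) hw').2
    rintro x ⟨hx, hzx⟩ y hy
    by_cases hyC : y ∈ C
    · have hyz := (hC.1.2.2 y hyC z hz).resolve_right (fun h' ↦ hy ⟨hyC, h'⟩)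
      exact Or.inr (h.trans hyz hzx)
    · exact hC.1.2.2 x hx y hyC
  obtain ⟨⟨c, hc⟩, ⟨z, hz⟩, -⟩ := hC.1
  by_cases hD : ∃ z ∉ C, Arc r c z
  · obtain ⟨d, hd, hcd⟩ := hD
    -- The outside vertices preceding `C` join it; all others follow `C`.
    refine ⟨C ∪ {z | Arc r z c}, ⟨c, Or.inl hc⟩, ⟨d, ?_⟩, ?_⟩
    · rintro (hd' | hd')
      · exact hd hd'
      · exact hcd.2 hd'.1
    · intro x hx y hy
      have hyC : y ∉ C := fun h' ↦ hy (Or.inl h')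
      have hCy : ∀ w ∈ C, Arc r w y :=
        (hmod y hyC).resolve_right (fun h' ↦ hy (Or.inr (h' c hc)))
      rcases hx with hx | hx
      · exact hCy x hx
      · exact h.trans hx (hCy c hc)
  · push Not at hD
    refine ⟨Cᶜ, ⟨z, hz⟩, ⟨c, not_not.2 hc⟩, fun x hx y hy ↦ ?_⟩
    exact (hmod x hx).resolve_left (fun h' ↦ hD x hx (h' c hc)) y (not_not.1 hy)

/-- The decomposition theorem for directed cographs. -/
lemma exists_isCut [Finite V] [Nontrivial V] (h : IsDirectedCograph r) :
    (∃ S, IsCut (Non r) S) ∨ (∃ S, IsCut (Edge r) S) ∨ ∃ S, IsCut (Arc r) S := by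
  rcases h.pathFree_adj.exists_isCut (fun x y ↦ Or.symm) with ⟨P, hP⟩ | ⟨P, hP⟩
  · rcases h.pathFree_not_edge.exists_isCut (fun x y hxy hyx ↦ hxy hyx.symm) with ⟨Q, hQ⟩ | ⟨Q, hQ⟩
    · refine Or.inr (Or.inr (h.exists_isCut_arc (h.exists_isCut_arc_or_arc (P := P) ?_ hQ)))
      exact ⟨hP.1, hP.2.1, fun x hx y hy hn ↦ (hP.2.2 x hx y hy).elim hn.1 hn.2⟩
    · exact Or.inr (Or.inl ⟨Q, by simpa only [not_not] using hQ⟩)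
  · exact Or.inl ⟨P, hP.1, hP.2.1, fun x hx y hy ↦ not_or.1 (hP.2.2 x hx y hy)⟩

/-- A smallest series factor is edgeless, or has a simple arc, or has a copy of `Y3`. -/
lemma exists_series_factor [Finite V] (h : IsDirectedCograph r) {S : Set V}
    (hS : IsCut (Edge r) S) : ∃ T ⊆ S, IsCut (Edge r) T ∧
      ((∀ x ∈ T, ∀ y ∈ T, Non r x y) ∨ (∃ a ∈ T, ∃ b ∈ T, Arc r a b) ∨
        ∃ a ∈ T, ∃ b ∈ T, ∃ c ∈ T, Edge r a b ∧ Non r a c ∧ Non r b c) := by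
  obtain ⟨T, hTS, hT⟩ := exists_minimal_le_of_wellFoundedLT _ S hS
  refine ⟨T, hTS, hT.1, ?_⟩
  by_contra! hcon
  obtain ⟨⟨a, ha, b, hb, hab⟩, hA, hY⟩ := hcon
  have hE : ∀ x ∈ T, ∀ y ∈ T, ¬ Non r x y → Edge r x y := by
    intro x hx y hy hn
    by_contra he
    rcases arc_or_arc_of_not he hn with h' | h'
    · exact hA x hx y hy h'
    · exact hA y hy x hx h'
  -- The non-neighbours of `a` in `T` form a smaller cut: `x` nonadjacent both to `a` and to a
  -- neighbour `y` of `a` would complete a `Y3`.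
  refine hab (hT.2 (y := {x ∈ T | Non r a x}) ⟨⟨a, ha, h.irrefl a, h.irrefl a⟩,
    ⟨b, fun h' ↦ hab h'.2⟩, ?_⟩ (fun x hx ↦ hx.1) hb).2
  rintro x ⟨hx, hax⟩ y hy
  by_cases hyT : y ∈ T
  · have hay := hE a ha y hyT (fun h' ↦ hy ⟨hyT, h'⟩)
    exact hE x hx y hyT fun hxy ↦ hY a ha y hyT x hx hay hax hxy.symm
  · exact hT.1.2.2 x hx y hyT

/-- A smallest initial order factor is edgeless or has a copy of `Y1` or `Y4`. -/
lemma exists_order_factor [Finite V] (h : IsDirectedCograph r) {S : Set V}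
    (hS : IsCut (Arc r) S) : ∃ T ⊆ S, IsCut (Arc r) T ∧
      ((∀ x ∈ T, ∀ y ∈ T, Non r x y) ∨ (∃ a ∈ T, ∃ b ∈ T, Edge r a b) ∨
        ∃ a ∈ T, ∃ b ∈ T, ∃ c ∈ T, Arc r a b ∧ Non r a c ∧ Non r b c) := by
  obtain ⟨T, hTS, hT⟩ := exists_minimal_le_of_wellFoundedLT _ S hS
  refine ⟨T, hTS, hT.1, ?_⟩
  by_contra! hcon
  obtain ⟨⟨a, ha, b, hb, hab⟩, hE, hY⟩ := hcon
  have hA : ∀ x ∈ T, ∀ y ∈ T, ¬ Non r x y → Arc r x y ∨ Arc r y x :=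
    fun x hx y hy ↦ arc_or_arc_of_not (hE x hx y hy)
  have : IsTrans V (Arc r) := ⟨fun _ _ _ ↦ h.trans⟩
  have : Std.Irrefl (Arc r) := ⟨fun x hx ↦ hx.2 hx.1⟩
  -- With a source `s`, arcs from the other vertices of `T` into the non-neighbours of `s` are
  -- impossible by transitivity. Minimality of `T` then makes `s` nonadjacent to all of `T`, so any
  -- arc there completes a `Y4`.
  obtain ⟨s, hs, hmin⟩ := (Finite.wellFounded_of_trans_of_irrefl (Arc r)).has_min T hT.1.1
  have hsmall : ∀ x ∈ T, Non r s x := by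
    refine fun x hx ↦ (hT.2 (y := {x ∈ T | Non r s x}) ⟨⟨s, hs, h.irrefl s, h.irrefl s⟩,
      hT.1.2.1.mono (Set.compl_subset_compl.2 (Set.sep_subset _ _)), ?_⟩ (fun x hx ↦ hx.1) hx).2
    rintro x ⟨hx, hsx⟩ y hy
    by_cases hyT : y ∈ T
    · have hsy := (hA s hs y hyT (fun h' ↦ hy ⟨hyT, h'⟩)).resolve_right (hmin y hyT)
      refine (hA x hx y hyT fun hxy ↦ hY s hs y hyT x hx hsy hsx hxy.symm).resolve_right ?_
      exact fun hyx ↦ hsx.1 (h.trans hsy hyx).1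
    · exact hT.1.2.2 x hx y hyT
  rcases hA a ha b hb hab with h' | h'
  · exact hY a ha b hb s hs h' (hsmall a ha).symm (hsmall b hb).symm
  · exact hY b hb a ha s hs h' (hsmall b hb).symm (hsmall a ha).symm

end IsDirectedCograph

end Relations

/-! ### Forbidden subdigraphs and edgeless factors -/

section Embeddings

variable {V W X : Type*} {r : V → V → Prop} {s : W → W → Prop}

/-- Vertices with the same image have the same in- and out-neighbours, so injectivity is automatic
when the pattern has no twins. -/
lemma nonempty_relEmbedding_of_twinFree
    (hs : ∀ x y, (∀ z, s x z ↔ s y z) → (∀ z, s z x ↔ s z y) → x = y)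
    (f : W → V) (hf : ∀ x y, r (f x) (f y) ↔ s x y) : Nonempty (s ↪r r) := by
  refine ⟨⟨⟨f, fun x y hxy ↦ hs x y (fun z ↦ ?_) (fun z ↦ ?_)⟩, hf _ _⟩⟩
  · rw [← hf, ← hf, hxy]
  · rw [← hf, ← hf, hxy]

instance (n : ℕ) (l : List (Fin n × Fin n)) : DecidableRel (ofArcs n l).Adj :=
  fun a b ↦ inferInstanceAs (Decidable ((a, b) ∈ l))

lemma nonempty_ofArcs_relEmbedding {n : ℕ} {l : List (Fin n × Fin n)}
    (hs : ∀ x y, (∀ z, (ofArcs n l).Adj x z ↔ (ofArcs n l).Adj y z) →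
      (∀ z, (ofArcs n l).Adj z x ↔ (ofArcs n l).Adj z y) → x = y)
    (f : Fin n → V) (hf : ∀ x y, r (f x) (f y) ↔ (x, y) ∈ l) :
    Nonempty ((ofArcs n l).Adj ↪r r) :=
  nonempty_relEmbedding_of_twinFree hs f hf

lemma nonempty_series_relEmbedding (hr : ∀ a, ¬ r a a) {G : Digraph W} {H : Digraph X}
    (f : G.Adj ↪r r) (g : H.Adj ↪r r) (hfg : ∀ x y, Edge r (f x) (g y)) :
    Nonempty ((series G H).Adj ↪r r) := by
  have hne : ∀ x y, f x ≠ g y := fun x y hxy ↦ hr (g y) (hxy ▸ (hfg x y).1)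
  refine ⟨⟨⟨Sum.elim f g, f.injective.sumElim g.injective hne⟩, ?_⟩⟩
  rintro (x | x) (y | y)
  · exact f.map_rel_iff
  · exact iff_of_true (hfg x y).1 trivial
  · exact iff_of_true (hfg y x).2 trivial
  · exact g.map_rel_iff

lemma nonempty_order_relEmbedding (hr : ∀ a, ¬ r a a) {G : Digraph W} {H : Digraph X}
    (f : G.Adj ↪r r) (g : H.Adj ↪r r) (hfg : ∀ x y, Arc r (f x) (g y)) :
    Nonempty ((order G H).Adj ↪r r) := by
  have hne : ∀ x y, f x ≠ g y := fun x y hxy ↦ hr (g y) (hxy ▸ (hfg x y).1)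
  refine ⟨⟨⟨Sum.elim f g, f.injective.sumElim g.injective hne⟩, ?_⟩⟩
  rintro (x | x) (y | y)
  · exact f.map_rel_iff
  · exact iff_of_true (hfg x y).1 trivial
  · exact iff_of_false (hfg y x).2 not_false
  · exact g.map_rel_iff

/-- The class of forbidden digraphs of the characterization. -/
def forbidden : Set (Σ W : Type, Digraph W) :=
  {⟨_, D1⟩, ⟨_, D2⟩, ⟨_, D3⟩, ⟨_, D4⟩, ⟨_, D5⟩, ⟨_, D6⟩, ⟨_, D7⟩, ⟨_, D8⟩,
    ⟨_, Q1⟩, ⟨_, Q2⟩, ⟨_, Q3⟩, ⟨_, Q4⟩, ⟨_, Q5⟩, ⟨_, Q6⟩, ⟨_, Q7⟩}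

lemma Free.of_relEmbedding {F : Set (Σ W : Type, Digraph W)} {G : Digraph V} {H : Digraph W}
    (hG : Free F G) (e : H.Adj ↪r G.Adj) : Free F H :=
  fun K hK ⟨f⟩ ↦ hG K hK ⟨f.trans e⟩

lemma isDirectedCograph_of_free {G : Digraph V} (hG : ∀ v, ¬ G.Adj v v) (hF : Free forbidden G) :
    IsDirectedCograph G.Adj := by
  have h1 := hF ⟨_, D1⟩ (by simp [forbidden])
  have h2 := hF ⟨_, D2⟩ (by simp [forbidden])
  have h3 := hF ⟨_, D3⟩ (by simp [forbidden])
  have h4 := hF ⟨_, D4⟩ (by simp [forbidden])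
  have h5 := hF ⟨_, D5⟩ (by simp [forbidden])
  have h6 := hF ⟨_, D6⟩ (by simp [forbidden])
  have h7 := hF ⟨_, D7⟩ (by simp [forbidden])
  have h8 := hF ⟨_, D8⟩ (by simp [forbidden])
  refine ⟨hG, ?_, ?_, ?_, ?_, ?_⟩
  · rintro a b c ⟨ab, ba⟩ ⟨bc, cb⟩
    by_contra hac
    by_cases ac : G.Adj a c <;> by_cases ca : G.Adj c a
    · exact h4 (nonempty_ofArcs_relEmbedding (by decide) ![a, b, c]
        (by simp [Fin.forall_fin_succ, *]))
    · exact hac ⟨ac, ca⟩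
    · exact h5 (nonempty_ofArcs_relEmbedding (by decide) ![a, b, c]
        (by simp [Fin.forall_fin_succ, *]))
    · exact h1 (nonempty_ofArcs_relEmbedding (by decide) ![a, b, c]
        (by simp [Fin.forall_fin_succ, *]))
  · rintro a b c ⟨ab, ba⟩ ⟨ac, ca⟩
    constructor
    · rintro ⟨bc, cb⟩
      exact h2 (nonempty_ofArcs_relEmbedding (by decide) ![a, b, c]
        (by simp [Fin.forall_fin_succ, *]))
    · rintro ⟨cb, bc⟩
      exact h3 (nonempty_ofArcs_relEmbedding (by decide) ![a, b, c]
        (by simp [Fin.forall_fin_succ, *]))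
  · rintro a b c d ⟨ba, ab⟩ ⟨bc, cb⟩ ⟨dc, cd⟩ ⟨ac, ca⟩ ⟨bd, db⟩ ⟨ad, da⟩
    exact h6 (nonempty_ofArcs_relEmbedding (by decide) ![a, b, c, d]
      (by simp [Fin.forall_fin_succ, *]))
  · rintro a b c d ⟨ba, ab⟩ ⟨bc, cb⟩ ⟨dc, cd⟩ ⟨ac, ca⟩ ⟨bd, db⟩ ⟨ad, da⟩
    exact h7 (nonempty_ofArcs_relEmbedding (by decide) ![a, b, c, d]
      (by simp [Fin.forall_fin_succ, *]))
  · rintro a b c d ⟨ba, ab⟩ ⟨bc, cb⟩ ⟨dc, cd⟩ ⟨ac, ca⟩ ⟨bd, db⟩ ⟨ad, da⟩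
    exact h8 (nonempty_ofArcs_relEmbedding (by decide) ![a, b, c, d]
      (by simp [Fin.forall_fin_succ, *]))

lemma exists_Y1_relEmbedding (hr : ∀ a, ¬ r a a) {T : Set V} {a b : V} (ha : a ∈ T) (hb : b ∈ T)
    (hab : Edge r a b) : ∃ f : Y1.Adj ↪r r, ∀ x, f x ∈ T := by
  have h : ∀ x, ![a, b] x ∈ T := by simp [Fin.forall_fin_succ, *]
  obtain ⟨ab, ba⟩ := hab
  obtain ⟨f⟩ := nonempty_ofArcs_relEmbedding (r := fun x y : T ↦ r x y)
    (l := [(0, 1), (1, 0)]) (by decide)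
    (fun x ↦ ⟨![a, b] x, h x⟩) (by simp [Fin.forall_fin_succ, *])
  exact ⟨f.trans (Subtype.relEmbedding r (· ∈ T)), fun x ↦ (f x).2⟩

lemma exists_Y2_relEmbedding (hr : ∀ a, ¬ r a a) {T : Set V} {a b : V} (ha : a ∈ T) (hb : b ∈ T)
    (hab : Arc r a b) : ∃ f : Y2.Adj ↪r r, ∀ x, f x ∈ T := by
  have h : ∀ x, ![a, b] x ∈ T := by simp [Fin.forall_fin_succ, *]
  obtain ⟨ab, ba⟩ := hab
  obtain ⟨f⟩ := nonempty_ofArcs_relEmbedding (r := fun x y : T ↦ r x y)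
    (l := [(0, 1)]) (by decide)
    (fun x ↦ ⟨![a, b] x, h x⟩) (by simp [Fin.forall_fin_succ, *])
  exact ⟨f.trans (Subtype.relEmbedding r (· ∈ T)), fun x ↦ (f x).2⟩

lemma exists_Y3_relEmbedding (hr : ∀ a, ¬ r a a) {T : Set V} {a b c : V} (ha : a ∈ T) (hb : b ∈ T)
    (hc : c ∈ T) (hab : Edge r a b) (hac : Non r a c) (hbc : Non r b c) :
    ∃ f : Y3.Adj ↪r r, ∀ x, f x ∈ T := by
  have h : ∀ x, ![a, b, c] x ∈ T := by simp [Fin.forall_fin_succ, *]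
  obtain ⟨ab, ba⟩ := hab
  obtain ⟨ac, ca⟩ := hac
  obtain ⟨bc, cb⟩ := hbc
  obtain ⟨f⟩ := nonempty_ofArcs_relEmbedding (r := fun x y : T ↦ r x y)
    (l := [(0, 1), (1, 0)]) (by decide)
    (fun x : Fin 3 ↦ ⟨![a, b, c] x, h x⟩) (by simp [Fin.forall_fin_succ, *])
  exact ⟨f.trans (Subtype.relEmbedding r (· ∈ T)), fun x ↦ (f x).2⟩

lemma exists_Y4_relEmbedding (hr : ∀ a, ¬ r a a) {T : Set V} {a b c : V} (ha : a ∈ T) (hb : b ∈ T)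
    (hc : c ∈ T) (hab : Arc r a b) (hac : Non r a c) (hbc : Non r b c) :
    ∃ f : Y4.Adj ↪r r, ∀ x, f x ∈ T := by
  have h : ∀ x, ![a, b, c] x ∈ T := by simp [Fin.forall_fin_succ, *]
  obtain ⟨ab, ba⟩ := hab
  obtain ⟨ac, ca⟩ := hac
  obtain ⟨bc, cb⟩ := hbc
  obtain ⟨f⟩ := nonempty_ofArcs_relEmbedding (r := fun x y : T ↦ r x y)
    (l := [(0, 1)]) (by decide)
    (fun x : Fin 3 ↦ ⟨![a, b, c] x, h x⟩) (by simp [Fin.forall_fin_succ, *])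
  exact ⟨f.trans (Subtype.relEmbedding r (· ∈ T)), fun x ↦ (f x).2⟩

lemma IsCut.compl_swap {R : V → V → Prop} {S : Set V} (h : IsCut R S) :
    IsCut (fun x y ↦ R y x) Sᶜ :=
  ⟨h.2.1, by simpa using h.1, fun x hx y hy ↦ h.2.2 y (not_not.1 hy) x hx⟩

/-- If the digraph is a series composition, then one factor can be taken edgeless. -/
lemma exists_isCut_edge_of_free [Finite V] {G : Digraph V} (hG : ∀ v, ¬ G.Adj v v)
    (hF : Free forbidden G) (hS : ∃ S, IsCut (Edge G.Adj) S) :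
    ∃ S, IsCut (Edge G.Adj) S ∧ ∀ x ∈ S, ∀ y ∈ S, Non G.Adj x y := by
  have hco := isDirectedCograph_of_free hG hF
  obtain ⟨S, hS⟩ := hS
  have hS' : IsCut (Edge G.Adj) Sᶜ :=
    ⟨hS.2.1, by simpa using hS.1, fun x hx y hy ↦ (hS.2.2 y (not_not.1 hy) x hx).symm⟩
  have key : ∀ {S}, IsCut (Edge G.Adj) S →
      (∃ S, IsCut (Edge G.Adj) S ∧ ∀ x ∈ S, ∀ y ∈ S, Non G.Adj x y) ∨
      (∃ f : Y2.Adj ↪r G.Adj, ∀ x, f x ∈ S) ∨ ∃ f : Y3.Adj ↪r G.Adj, ∀ x, f x ∈ S := by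
    intro S hS
    obtain ⟨T, hTS, hT, hN | ⟨a, ha, b, hb, hab⟩ | ⟨a, ha, b, hb, c, hc, hab, hac, hbc⟩⟩ :=
      hco.exists_series_factor hS
    · exact Or.inl ⟨T, hT, hN⟩
    · exact Or.inr (Or.inl (exists_Y2_relEmbedding hG (hTS ha) (hTS hb) hab))
    · exact Or.inr (Or.inr
        (exists_Y3_relEmbedding hG (hTS ha) (hTS hb) (hTS hc) hab hac hbc))
  have hQ1 := hF ⟨_, Q1⟩ (by simp [forbidden])
  have hQ3 := hF ⟨_, Q3⟩ (by simp [forbidden])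
  have hQ4 := hF ⟨_, Q4⟩ (by simp [forbidden])
  rcases key hS with h | ⟨f, hf⟩ | ⟨f, hf⟩
  · exact h
  all_goals rcases key hS' with h | ⟨g, hg⟩ | ⟨g, hg⟩
  · exact h
  · exact (hQ1 (nonempty_series_relEmbedding hG f g
      fun x y ↦ hS.2.2 _ (hf x) _ (hg y))).elim
  · exact (hQ4 (nonempty_series_relEmbedding hG f g
      fun x y ↦ hS.2.2 _ (hf x) _ (hg y))).elim
  · exact h
  · exact (hQ4 (nonempty_series_relEmbedding hG g f
      fun x y ↦ (hS.2.2 _ (hf y) _ (hg x)).symm)).elim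
  · exact (hQ3 (nonempty_series_relEmbedding hG f g
      fun x y ↦ hS.2.2 _ (hf x) _ (hg y))).elim

/-- If the digraph is an order composition, then one factor can be taken edgeless. -/
lemma exists_isCut_arc_of_free [Finite V] {G : Digraph V} (hG : ∀ v, ¬ G.Adj v v)
    (hF : Free forbidden G) (hS : ∃ S, IsCut (Arc G.Adj) S) :
    (∃ S, IsCut (Arc G.Adj) S ∧ ∀ x ∈ S, ∀ y ∈ S, Non G.Adj x y) ∨
      ∃ S, IsCut (Arc G.Adj) S ∧ ∀ x ∉ S, ∀ y ∉ S, Non G.Adj x y := by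
  have hco := isDirectedCograph_of_free hG hF
  obtain ⟨S, hS⟩ := hS
  have key : (∃ S, IsCut (Arc G.Adj) S ∧ ∀ x ∈ S, ∀ y ∈ S, Non G.Adj x y) ∨
      (∃ f : Y1.Adj ↪r G.Adj, ∀ x, f x ∈ S) ∨ ∃ f : Y4.Adj ↪r G.Adj, ∀ x, f x ∈ S := by
    obtain ⟨T, hTS, hT, hN | ⟨a, ha, b, hb, hab⟩ | ⟨a, ha, b, hb, c, hc, hab, hac, hbc⟩⟩ :=
      hco.exists_order_factor hS
    · exact Or.inl ⟨T, hT, hN⟩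
    · exact Or.inr (Or.inl (exists_Y1_relEmbedding hG (hTS ha) (hTS hb) hab))
    · exact Or.inr (Or.inr
        (exists_Y4_relEmbedding hG (hTS ha) (hTS hb) (hTS hc) hab hac hbc))
  -- The same argument in the reversed digraph, where the complement of `S` is the initial factor.
  have key' : (∃ S, IsCut (Arc G.Adj) S ∧ ∀ x ∉ S, ∀ y ∉ S, Non G.Adj x y) ∨
      (∃ f : Y1.Adj ↪r G.Adj, ∀ x, f x ∈ Sᶜ) ∨ ∃ f : Y4.Adj ↪r G.Adj, ∀ x, f x ∈ Sᶜ := by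
    obtain ⟨T, hTS, hT, hN | ⟨a, ha, b, hb, hab⟩ | ⟨a, ha, b, hb, c, hc, hab, hac, hbc⟩⟩ :=
      hco.swap.exists_order_factor hS.compl_swap
    · exact Or.inl ⟨Tᶜ, hT.compl_swap, fun x hx y hy ↦
        (hN x (not_not.1 hx) y (not_not.1 hy)).symm⟩
    · exact Or.inr (Or.inl (exists_Y1_relEmbedding hG (hTS ha) (hTS hb) hab.symm))
    · exact Or.inr (Or.inr
        (exists_Y4_relEmbedding hG (hTS hb) (hTS ha) (hTS hc) hab hbc.symm hac.symm))
  have hQ2 := hF ⟨_, Q2⟩ (by simp [forbidden])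
  have hQ5 := hF ⟨_, Q5⟩ (by simp [forbidden])
  have hQ6 := hF ⟨_, Q6⟩ (by simp [forbidden])
  have hQ7 := hF ⟨_, Q7⟩ (by simp [forbidden])
  rcases key with h | ⟨f, hf⟩ | ⟨f, hf⟩
  · exact Or.inl h
  all_goals
    rcases key' with h | ⟨g, hg⟩ | ⟨g, hg⟩
    · exact Or.inr h
    all_goals
      have := nonempty_order_relEmbedding hG f g fun x y ↦ hS.2.2 _ (hf x) _ (hg y)
      exact absurd this (by assumption)

end Embeddings

/-! ### Rebuilding a digraph from its cuts -/

section Decomposition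

variable {V : Type u} {G : Digraph V}

/-- The subdigraph induced by a set of vertices. -/
def restrict (G : Digraph V) (S : Set V) : Digraph S where
  Adj x y := G.Adj x y

lemma isDWQT_of_isCut_non {S : Set V} (hS : IsCut (Non G.Adj) S) (h1 : IsDWQT (restrict G S))
    (h2 : IsDWQT (restrict G Sᶜ)) : IsDWQT G := by
  classical
  refine .iso ⟨Equiv.Set.sumCompl S, ?_⟩ (.disjUnion h1 h2)
  rintro (x | x) (y | y)
  · exact Iff.rfl
  · exact iff_of_false (hS.2.2 x x.2 y y.2).1 not_false
  · exact iff_of_false (hS.2.2 y y.2 x x.2).2 not_false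
  · exact Iff.rfl

lemma isDWQT_of_isCut_edge [Finite V] {S : Set V} (hS : IsCut (Edge G.Adj) S)
    (h1 : ∀ x ∈ S, ∀ y ∈ S, Non G.Adj x y) (h2 : IsDWQT (restrict G Sᶜ)) : IsDWQT G := by
  classical
  refine .iso ⟨(Equiv.sumComm _ _).trans (Equiv.Set.sumCompl S), ?_⟩ (.series S h2)
  rintro (x | x) (y | y)
  · exact Iff.rfl
  · exact iff_of_true (hS.2.2 y y.2 x x.2).2 trivial
  · exact iff_of_true (hS.2.2 x x.2 y y.2).1 trivial
  · exact iff_of_false (h1 x x.2 y y.2).1 not_false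

lemma isDWQT_of_isCut_arc_left [Finite V] {S : Set V} (hS : IsCut (Arc G.Adj) S)
    (h1 : ∀ x ∈ S, ∀ y ∈ S, Non G.Adj x y) (h2 : IsDWQT (restrict G Sᶜ)) : IsDWQT G := by
  classical
  refine .iso ⟨Equiv.Set.sumCompl S, ?_⟩ (.orderLeft S h2)
  rintro (x | x) (y | y)
  · exact iff_of_false (h1 x x.2 y y.2).1 not_false
  · exact iff_of_true (hS.2.2 x x.2 y y.2).1 trivial
  · exact iff_of_false (hS.2.2 y y.2 x x.2).2 not_false
  · exact Iff.rfl

lemma isDWQT_of_isCut_arc_right [Finite V] {S : Set V} (hS : IsCut (Arc G.Adj) S)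
    (h1 : IsDWQT (restrict G S)) (h2 : ∀ x ∉ S, ∀ y ∉ S, Non G.Adj x y) : IsDWQT G := by
  classical
  refine .iso ⟨Equiv.Set.sumCompl S, ?_⟩ (.orderRight ↥Sᶜ h1)
  rintro (x | x) (y | y)
  · exact Iff.rfl
  · exact iff_of_true (hS.2.2 x x.2 y y.2).1 trivial
  · exact iff_of_false (hS.2.2 y y.2 x x.2).2 not_false
  · exact iff_of_false (h2 x x.2 y y.2).1 not_false

theorem isDWQT_of_free [Finite V] (hG : ∀ v, ¬ G.Adj v v) (hF : Free forbidden G) :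
    IsDWQT G := by
  obtain ⟨n, hn⟩ : ∃ n, Nat.card V = n := ⟨_, rfl⟩
  induction n using Nat.strong_induction_on generalizing V with
  | _ n ih =>
  have hrec : ∀ S : Set V, Sᶜ.Nonempty → IsDWQT (restrict G S) := by
    rintro S ⟨v, hv⟩
    refine ih _ ?_ (fun x ↦ hG x) (hF.of_relEmbedding (Subtype.relEmbedding G.Adj (· ∈ S))) rfl
    rw [← hn]
    exact Finite.card_subtype_lt hv
  rcases subsingleton_or_nontrivial V with hV | hV
  · have : G = ⊥ := by
      ext x y
      rw [Subsingleton.elim y x]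
      exact iff_of_false (hG x) not_false
    rw [this]
    exact .edgeless V
  · rcases (isDirectedCograph_of_free hG hF).exists_isCut with ⟨S, hS⟩ | hS | hS
    · exact isDWQT_of_isCut_non hS (hrec S hS.2.1) (hrec _ (by simpa using hS.1))
    · obtain ⟨S, hS, hN⟩ := exists_isCut_edge_of_free hG hF hS
      exact isDWQT_of_isCut_edge hS hN (hrec _ (by simpa using hS.1))
    · rcases exists_isCut_arc_of_free hG hF hS with ⟨S, hS, hN⟩ | ⟨S, hS, hN⟩
      · exact isDWQT_of_isCut_arc_left hS hN (hrec _ (by simpa using hS.1))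
      · exact isDWQT_of_isCut_arc_right hS (hrec S hS.2.1) hN

end Decomposition

/-! ### Obstructions to the generating operations -/

section Obstructions

variable {V W X : Type*} {r : V → V → Prop} {s : W → W → Prop}

/-- A relation that is not edgeless and is not decomposed by any of the operations that generate
the weakly quasi threshold graphs. A two-colouring of the vertices stands for the two factors. -/
structure IsObstruction (s : W → W → Prop) : Prop where
  nonempty : ∃ x y, s x y
  connected : ∀ c : W → Bool, (∀ x y, s x y → c x = c y) → (∀ x, c x = true) ∨ ∀ x, c x = false
  -- In this and the next two fields `false` marks the edgeless factor, which must miss the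
  -- obstruction.
  series : ∀ c : W → Bool, (∀ x y, c x = true → c y = false → s x y ∧ s y x) →
    (∀ x y, c x = false → c y = false → ¬ s x y) → ∀ x, c x = true
  orderRight : ∀ c : W → Bool, (∀ x y, c x = true → c y = false → s x y ∧ ¬ s y x) →
    (∀ x y, c x = false → c y = false → ¬ s x y) → ∀ x, c x = true
  orderLeft : ∀ c : W → Bool, (∀ x y, c x = false → c y = true → s x y ∧ ¬ s y x) →
    (∀ x y, c x = false → c y = false → ¬ s x y) → ∀ x, c x = true

lemma nonempty_relEmbedding_of_isLeft {t : V ⊕ X → V ⊕ X → Prop} (e : s ↪r t)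
    (ht : ∀ a b, t (.inl a) (.inl b) ↔ r a b) (he : ∀ x, (e x).isLeft = true) :
    Nonempty (s ↪r r) := by
  choose f hf using fun x ↦ Sum.isLeft_iff.1 (he x)
  refine ⟨⟨⟨f, fun x y hxy ↦ e.injective (by rw [hf, hf, hxy])⟩, fun {x y} ↦ ?_⟩⟩
  rw [← e.map_rel_iff, hf, hf, ht]
  rfl

lemma nonempty_relEmbedding_of_isRight {t : X ⊕ V → X ⊕ V → Prop} (e : s ↪r t)
    (ht : ∀ a b, t (.inr a) (.inr b) ↔ r a b) (he : ∀ x, (e x).isRight = true) :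
    Nonempty (s ↪r r) := by
  choose f hf using fun x ↦ Sum.isRight_iff.1 (he x)
  refine ⟨⟨⟨f, fun x y hxy ↦ e.injective (by rw [hf, hf, hxy])⟩, fun {x y} ↦ ?_⟩⟩
  rw [← e.map_rel_iff, hf, hf, ht]
  rfl

namespace IsObstruction

lemma not_embeds_disjUnion (hs : IsObstruction s) {t : V ⊕ X → V ⊕ X → Prop} {r' : X → X → Prop}
    (h1 : ∀ a b, t (.inl a) (.inl b) ↔ r a b) (h2 : ∀ a b, t (.inr a) (.inr b) ↔ r' a b)
    (h3 : ∀ a b, ¬ t (.inl a) (.inr b)) (h4 : ∀ a b, ¬ t (.inr a) (.inl b))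
    (hr : ¬ Nonempty (s ↪r r)) (hr' : ¬ Nonempty (s ↪r r')) : ¬ Nonempty (s ↪r t) := by
  rintro ⟨e⟩
  have hc : ∀ x y, s x y → (e x).isLeft = (e y).isLeft := by
    intro x y hxy
    rw [← e.map_rel_iff] at hxy
    generalize e x = p, e y = q at *
    rcases p with a | a <;> rcases q with b | b <;> simp_all
  rcases hs.connected (fun x ↦ (e x).isLeft) hc with h | h
  · exact hr (nonempty_relEmbedding_of_isLeft e h1 h)
  · exact hr' (nonempty_relEmbedding_of_isRight e h2 (by simpa using h))

lemma not_embeds_series (hs : IsObstruction s) {t : V ⊕ X → V ⊕ X → Prop}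
    (h1 : ∀ a b, t (.inl a) (.inl b) ↔ r a b) (h2 : ∀ a b, ¬ t (.inr a) (.inr b))
    (h3 : ∀ a b, t (.inl a) (.inr b)) (h4 : ∀ a b, t (.inr a) (.inl b))
    (hr : ¬ Nonempty (s ↪r r)) : ¬ Nonempty (s ↪r t) := by
  rintro ⟨e⟩
  refine hr (nonempty_relEmbedding_of_isLeft e h1
    (hs.series (fun x ↦ (e x).isLeft) (fun x y hx hy ↦ ?_) (fun x y hx hy ↦ ?_)))
  all_goals
    simp only [← e.map_rel_iff]
    generalize e x = p, e y = q at *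
    rcases p with a | a <;> rcases q with b | b <;> simp_all

lemma not_embeds_orderRight (hs : IsObstruction s) {t : V ⊕ X → V ⊕ X → Prop}
    (h1 : ∀ a b, t (.inl a) (.inl b) ↔ r a b) (h2 : ∀ a b, ¬ t (.inr a) (.inr b))
    (h3 : ∀ a b, t (.inl a) (.inr b)) (h4 : ∀ a b, ¬ t (.inr a) (.inl b))
    (hr : ¬ Nonempty (s ↪r r)) : ¬ Nonempty (s ↪r t) := by
  rintro ⟨e⟩
  refine hr (nonempty_relEmbedding_of_isLeft e h1
    (hs.orderRight (fun x ↦ (e x).isLeft) (fun x y hx hy ↦ ?_) (fun x y hx hy ↦ ?_)))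
  all_goals
    simp only [← e.map_rel_iff]
    generalize e x = p, e y = q at *
    rcases p with a | a <;> rcases q with b | b <;> simp_all

lemma not_embeds_orderLeft (hs : IsObstruction s) {t : X ⊕ V → X ⊕ V → Prop}
    (h1 : ∀ a b, t (.inr a) (.inr b) ↔ r a b) (h2 : ∀ a b, ¬ t (.inl a) (.inl b))
    (h3 : ∀ a b, t (.inl a) (.inr b)) (h4 : ∀ a b, ¬ t (.inr a) (.inl b))
    (hr : ¬ Nonempty (s ↪r r)) : ¬ Nonempty (s ↪r t) := by
  rintro ⟨e⟩
  refine hr (nonempty_relEmbedding_of_isRight e h1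
    (hs.orderLeft (fun x ↦ (e x).isRight) (fun x y hx hy ↦ ?_) (fun x y hx hy ↦ ?_)))
  all_goals
    simp only [← e.map_rel_iff]
    generalize e x = p, e y = q at *
    rcases p with a | a <;> rcases q with b | b <;> simp_all

/-- Colouring each vertex of the obstruction by the factor it lands in puts it inside one smaller
member of the class. -/
lemma not_embeds_of_isDWQT (hs : IsObstruction s) {V : Type u} {G : Digraph V} (hG : IsDWQT G) :
    ¬ Nonempty (s ↪r G.Adj) := by
  induction hG with
  | edgeless V =>
    rintro ⟨e⟩
    obtain ⟨x, y, hxy⟩ := hs.nonempty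
    exact e.map_rel_iff.2 hxy
  | disjUnion _ _ h1 h2 =>
    exact hs.not_embeds_disjUnion (fun _ _ ↦ Iff.rfl) (fun _ _ ↦ Iff.rfl) (fun _ _ ↦ not_false)
      (fun _ _ ↦ not_false) h1 h2
  | orderRight W _ h =>
    exact hs.not_embeds_orderRight (fun _ _ ↦ Iff.rfl) (fun _ _ ↦ not_false) (fun _ _ ↦ trivial)
      (fun _ _ ↦ not_false) h
  | orderLeft W _ h =>
    exact hs.not_embeds_orderLeft (fun _ _ ↦ Iff.rfl) (fun _ _ ↦ not_false) (fun _ _ ↦ trivial)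
      (fun _ _ ↦ not_false) h
  | series W _ h =>
    exact hs.not_embeds_series (fun _ _ ↦ Iff.rfl) (fun _ _ ↦ not_false) (fun _ _ ↦ trivial)
      (fun _ _ ↦ trivial) h
  | iso f _ h => exact fun ⟨e⟩ ↦ h ⟨e.trans f.symm.toRelEmbedding⟩

lemma not_embeds_of_isWQT (hs : IsObstruction s) {V : Type u} {G : SimpleGraph V} (hG : IsWQT G) :
    ¬ Nonempty (s ↪r G.Adj) := by
  induction hG with
  | edgeless V =>
    rintro ⟨e⟩
    obtain ⟨x, y, hxy⟩ := hs.nonempty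
    exact e.map_rel_iff.2 hxy
  | disjUnion _ _ h1 h2 =>
    exact hs.not_embeds_disjUnion (by simp) (by simp) (by simp) (by simp) h1 h2
  | join W _ h =>
    exact hs.not_embeds_series (by simp [join]) (by simp [join]) (by simp [join])
      (by simp [join]) h
  | iso f _ h => exact fun ⟨e⟩ ↦ h ⟨e.trans f.symm.toRelEmbedding⟩

end IsObstruction

/-! ### Finite checks over all two-colourings -/

instance {G : Digraph V} {H : Digraph W} [DecidableRel G.Adj] [DecidableRel H.Adj] :
    DecidableRel (series G H).Adj
  | .inl a, .inl b => inferInstanceAs (Decidable (G.Adj a b))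
  | .inr a, .inr b => inferInstanceAs (Decidable (H.Adj a b))
  | .inl _, .inr _ => inferInstanceAs (Decidable True)
  | .inr _, .inl _ => inferInstanceAs (Decidable True)

instance {G : Digraph V} {H : Digraph W} [DecidableRel G.Adj] [DecidableRel H.Adj] :
    DecidableRel (order G H).Adj
  | .inl a, .inl b => inferInstanceAs (Decidable (G.Adj a b))
  | .inr a, .inr b => inferInstanceAs (Decidable (H.Adj a b))
  | .inl _, .inr _ => inferInstanceAs (Decidable True)
  | .inr _, .inl _ => inferInstanceAs (Decidable False)

instance : DecidableRel Y1.Adj := inferInstanceAs (DecidableRel (ofArcs _ _).Adj)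
instance : DecidableRel Y2.Adj := inferInstanceAs (DecidableRel (ofArcs _ _).Adj)
instance : DecidableRel Y3.Adj := inferInstanceAs (DecidableRel (ofArcs _ _).Adj)
instance : DecidableRel Y4.Adj := inferInstanceAs (DecidableRel (ofArcs _ _).Adj)

lemma P4_adj (x y : Fin 4) : P4.Adj x y ↔ x.val + 1 = y.val ∨ y.val + 1 = x.val :=
  SimpleGraph.pathGraph_adj

instance : DecidableRel P4.Adj := fun x y ↦ decidable_of_iff _ (P4_adj x y).symm

instance : DecidableRel (SimpleGraph.pathGraph 3).Adj :=
  fun _ _ ↦ decidable_of_iff _ SimpleGraph.pathGraph_adj.symm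

instance {G : SimpleGraph V} {H : SimpleGraph W} [DecidableRel G.Adj] [DecidableRel H.Adj] :
    DecidableRel (G.sum H).Adj
  | .inl a, .inl b => decidable_of_iff (G.Adj a b) (by simp)
  | .inr a, .inr b => decidable_of_iff (H.Adj a b) (by simp)
  | .inl _, .inr _ => .isFalse (by simp)
  | .inr _, .inl _ => .isFalse (by simp)

instance : DecidableRel co2P3.Adj :=
  inferInstanceAs (DecidableRel ((SimpleGraph.pathGraph 3).sum (SimpleGraph.pathGraph 3))ᶜ.Adj)

lemma isObstruction_ofArcs_three (l : List (Fin 3 × Fin 3))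
    (h : l ∈ [[(0, 1), (1, 2)], [(0, 1), (1, 0), (1, 2)], [(0, 1), (1, 0), (2, 1)],
      [(0, 1), (1, 2), (0, 2), (2, 0)], [(0, 1), (1, 2), (2, 0)]]) :
    IsObstruction (ofArcs 3 l).Adj := by
  revert l
  simp only [List.forall_mem_cons, List.not_mem_nil, IsEmpty.forall_iff, implies_true, and_true]
  refine ⟨?_, ?_, ?_, ?_, ?_⟩ <;> constructor <;> decide +kernel

lemma isObstruction_ofArcs_four (l : List (Fin 4 × Fin 4))
    (h : l ∈ [[(1, 0), (1, 2), (3, 2), (0, 2), (2, 0), (0, 3), (3, 0), (1, 3), (3, 1)],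
      [(0, 1), (1, 0), (1, 2), (2, 1), (2, 3), (3, 2)], [(0, 1), (2, 1), (2, 3)]]) :
    IsObstruction (ofArcs 4 l).Adj := by
  revert l
  simp only [List.forall_mem_cons, List.not_mem_nil, IsEmpty.forall_iff, implies_true, and_true]
  refine ⟨?_, ?_, ?_⟩ <;> constructor <;> decide +kernel

lemma isObstruction_of_mem_forbidden (H : Σ W : Type, Digraph W) (hH : H ∈ forbidden) :
    IsObstruction H.2.Adj := by
  rcases hH with rfl | rfl | rfl | rfl | rfl | rfl | rfl | rfl | rfl | rfl | rfl | rfl | rfl |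
    rfl | rfl
  · exact isObstruction_ofArcs_three _ (by simp)
  · exact isObstruction_ofArcs_three _ (by simp)
  · exact isObstruction_ofArcs_three _ (by simp)
  · exact isObstruction_ofArcs_three _ (by simp)
  · exact isObstruction_ofArcs_three _ (by simp)
  · exact isObstruction_ofArcs_four _ (by simp)
  · exact isObstruction_ofArcs_four _ (by simp)
  · exact isObstruction_ofArcs_four _ (by simp)
  · change IsObstruction (series Y2 Y2).Adj
    constructor <;> decide +kernel
  · change IsObstruction (order Y1 Y1).Adj
    constructor <;> decide +kernel
  · change IsObstruction (series Y3 Y3).Adj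
    constructor <;> decide +kernel
  · change IsObstruction (series Y2 Y3).Adj
    constructor <;> decide +kernel
  · change IsObstruction (order Y1 Y4).Adj
    constructor <;> decide +kernel
  · change IsObstruction (order Y4 Y1).Adj
    constructor <;> decide +kernel
  · change IsObstruction (order Y4 Y4).Adj
    constructor <;> decide +kernel

lemma isObstruction_P4 : IsObstruction P4.Adj := by constructor <;> decide +kernel

lemma isObstruction_co2P3 : IsObstruction co2P3.Adj := by constructor <;> decide +kernel

lemma uFree_of_isWQT {V : Type u} {G : SimpleGraph V} (hG : IsWQT G) :
    UFree {⟨_, P4⟩, ⟨_, co2P3⟩} G := by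
  rintro _ (rfl | rfl)
  · exact isObstruction_P4.not_embeds_of_isWQT hG
  · exact isObstruction_co2P3.not_embeds_of_isWQT hG

/-! ### Passage to the underlying graph -/

lemma un_adj {G : Digraph V} {x y : V} : (un G).Adj x y ↔ x ≠ y ∧ (G.Adj x y ∨ G.Adj y x) :=
  Iff.rfl

lemma isIndContained_un {K : SimpleGraph X} {H : Digraph W} {G : Digraph V} (f : X ↪ W)
    (hf : ∀ x y, K.Adj x y ↔ x ≠ y ∧ (H.Adj (f x) (f y) ∨ H.Adj (f y) (f x)))
    (hK : ¬ K.IsIndContained (un G)) : ¬ Nonempty (H.Adj ↪r G.Adj) := by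
  rintro ⟨e⟩
  refine hK ⟨⟨f.trans e.toEmbedding, fun {x y} ↦ ?_⟩⟩
  rw [hf, un_adj]
  simp [e.map_rel_iff]

/-- Exchanges the two ends of the path with its middle, to compare `pathGraph 3` with the
complement of `Y3` and of `Y4`. -/
def pathRelabel : Fin 3 ⊕ Fin 3 ↪ Fin 3 ⊕ Fin 3 :=
  (Equiv.sumCongr (Equiv.swap 1 2) (Equiv.swap 1 2)).toEmbedding

lemma free_of_uFree_un {G : Digraph V}
    (hG : Free {⟨_, D1⟩, ⟨_, D2⟩, ⟨_, D3⟩, ⟨_, D4⟩, ⟨_, D5⟩, ⟨_, D6⟩,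
        ⟨_, Q1⟩, ⟨_, Q2⟩, ⟨_, Q4⟩, ⟨_, Q5⟩, ⟨_, Q6⟩} G)
    (hU : UFree {⟨_, P4⟩, ⟨_, co2P3⟩} (un G)) : Free forbidden G := by
  have hP := hU ⟨_, P4⟩ (by simp)
  have hC := hU ⟨_, co2P3⟩ (by simp)
  have h7 : ¬ Nonempty (D7.Adj ↪r G.Adj) :=
    isIndContained_un (.refl _) (by unfold D7; decide +kernel) hP
  have h8 : ¬ Nonempty (D8.Adj ↪r G.Adj) :=
    isIndContained_un (.refl _) (by unfold D8; decide +kernel) hP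
  have h3 : ¬ Nonempty (Q3.Adj ↪r G.Adj) :=
    isIndContained_un pathRelabel (by unfold Q3; decide +kernel) hC
  have h7' : ¬ Nonempty (Q7.Adj ↪r G.Adj) :=
    isIndContained_un pathRelabel (by unfold Q7; decide +kernel) hC
  rintro H (rfl | rfl | rfl | rfl | rfl | rfl | rfl | rfl | rfl | rfl | rfl | rfl | rfl |
    rfl | rfl)
  all_goals first | assumption | exact hG _ (by simp)

/-- Both order compositions and the series composition become joins with an edgeless graph. -/
lemma isWQT_un {V : Type u} {G : Digraph V} (hG : IsDWQT G) : IsWQT (un G) := by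
  induction hG with
  | edgeless V =>
    refine .iso ⟨Equiv.refl V, ?_⟩ (.edgeless V)
    simp [un_adj]
  | disjUnion _ _ h1 h2 =>
    refine .iso ⟨Equiv.refl _, ?_⟩ (.disjUnion h1 h2)
    rintro (x | x) (y | y) <;> simp [un_adj, disjUnion]
  | orderRight W _ h =>
    refine .iso ⟨Equiv.refl _, ?_⟩ (.join W h)
    rintro (x | x) (y | y) <;> simp [un_adj, order, join]
  | orderLeft W _ h =>
    refine .iso ⟨Equiv.sumComm _ _, ?_⟩ (.join W h)
    rintro (x | x) (y | y) <;> simp [un_adj, order, join]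
  | series W _ h =>
    refine .iso ⟨Equiv.refl _, ?_⟩ (.join W h)
    rintro (x | x) (y | y) <;> simp [un_adj, series, join]
  | iso f _ h =>
    refine .iso ⟨f.toEquiv, ?_⟩ h
    simp [un_adj, f.map_rel_iff]

end Obstructions

end DirectedWQT

open DirectedWQT in
theorem mainTheorem6 {V : Type*} [Finite V] (G : Digraph V) (hG : ∀ v, ¬ G.Adj v v) :
    List.TFAE [
      IsDWQT G,
      Free {⟨_, D1⟩, ⟨_, D2⟩, ⟨_, D3⟩, ⟨_, D4⟩, ⟨_, D5⟩, ⟨_, D6⟩, ⟨_, D7⟩, ⟨_, D8⟩,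
        ⟨_, Q1⟩, ⟨_, Q2⟩, ⟨_, Q3⟩, ⟨_, Q4⟩, ⟨_, Q5⟩, ⟨_, Q6⟩, ⟨_, Q7⟩} G,
      Free {⟨_, D1⟩, ⟨_, D2⟩, ⟨_, D3⟩, ⟨_, D4⟩, ⟨_, D5⟩, ⟨_, D6⟩,
        ⟨_, Q1⟩, ⟨_, Q2⟩, ⟨_, Q4⟩, ⟨_, Q5⟩, ⟨_, Q6⟩} G ∧
        UFree {⟨_, P4⟩, ⟨_, co2P3⟩} (un G),
      Free {⟨_, D1⟩, ⟨_, D2⟩, ⟨_, D3⟩, ⟨_, D4⟩, ⟨_, D5⟩, ⟨_, D6⟩,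
        ⟨_, Q1⟩, ⟨_, Q2⟩, ⟨_, Q4⟩, ⟨_, Q5⟩, ⟨_, Q6⟩} G ∧
        IsWQT (un G)] := by
  tfae_have 1 → 4 := fun h ↦
    ⟨fun H hH ↦ (isObstruction_of_mem_forbidden H
      (by simp only [forbidden, Set.mem_insert_iff, Set.mem_singleton_iff] at hH ⊢; tauto)
      ).not_embeds_of_isDWQT h, isWQT_un h⟩
  tfae_have 4 → 3 := fun h ↦ ⟨h.1, uFree_of_isWQT h.2⟩
  tfae_have 3 → 2 := fun h ↦ free_of_uFree_un h.1 h.2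
  -- Looplessness matters here: a single looped vertex avoids every forbidden digraph but is not in
  -- the class.
  tfae_have 2 → 1 := isDWQT_of_free hG
  tfae_finish
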